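/- Let $n \ge 0$ and let $S_{2n}$ be the symmetric group on $\{1,\dots,2n\}$, with simple transpositions $s_i=(i,i+1)$ and Coxeter length $\ell$. Let $\circ$ be the Demazure product on $S_{2n}$, i.e. the unique associative product with $w\circ s_i = ws_i$ if $\ell(ws_i)>\ell(w)$ and $w\circ s_i=w$ otherwise, and $s_i\circ w = s_iw$ if $\ell(s_iw)>\ell(w)$ and $s_i\circ w=w$ otherwise. Put $w_{\mathrm{FPF}} = s_1s_3s_5\cdots s_{2n-1}$. For a fixed-point-free involution $x\in S_{2n}$ let $\mathcal{A}_{\mathrm{FPF}}(x)$ be the set of minimal-length elements of $\{w\in S_{2n} : w^{-1}\circ w_{\mathrm{FPF}}\circ w = x\}$, and let $\mathcal{A}_{\mathrm{FPF}}(x)^{-1}=\{w^{-1} : w\in \mathcal{A}_{\mathrm{FPF}}(x)\}$. Let $\prec$ be the transitive closure of the relation on integer sequences of length $2n$ given by $$[\alpha_1,\dots,\alpha_{2i},\,a,d,b,c,\,\beta_1,\dots,\beta_{2k}] \prec [\alpha_1,\dots,\alpha_{2i},\,b,c,a,d,\,\beta_1,\dots,\beta_{2k}]$$ for all integers $a\le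 b\le c\le d$ and all even-length (possibly empty) integer sequences $\alpha,\beta$ with $2i+4+2k=2n$, and write $u \preceq v$ if $u=v$ or $u\prec v$. Identify each $u\in S_{2n}$ with its one-line representation $[u(1),u(2),\dots,u(2n)]$. Write the set of pairs $\{(a,b) : a\le b=x(a)\}$ both as $\{(a_1,b_1),\dots,(a_n,b_n)\}$ with $a_1<a_2<\dots<a_n$ and as $\{(c_1,d_1),\dots,(c_n,d_n)\}$ with $d_1<d_2<\dots<d_n$, and define the permutations $$\hat 0_{\mathrm{FPF}}(x)=[a_1,b_1,a_2,b_2,\dots,a_n,b_n],\qquad \hat 1_{\mathrm{FPF}}(x)=[c_1,d_1,c_2,d_2,\dots,c_n,d_n].$$ Theorem. For every fixed-point-free involution $x\in S_{2n}$, $$\mathcal{A}_{\mathrm{FPF}}(x)^{-1}=\{u\in S_{2n} : \hat 0_{\mathrm{FPF}}(x)\preceq u\}=\{u\in S_{2n} : u\preceq \hat 1_{\mathrm{FPF}}(x)\}.$$ -/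

import Mathlib

namespace FPFAtoms

open Equiv

/-! The symmetric group on `m` letters is `Perm (Fin m)`; positions and values are indexed from `0`
instead of `1`, and the product is composition of maps. -/

/-- The adjacent transposition of the letters `i` and `i + 1` (counted from `0`). -/
def simpleRefl (m : ℕ) (i : Fin (m - 1)) : Perm (Fin m) :=
  swap ⟨i.1, by omega⟩ ⟨i.1 + 1, by omega⟩

/-- The product of a word in the adjacent transpositions. -/
def wordProd {m : ℕ} (ω : List (Fin (m - 1))) : Perm (Fin m) :=
  (ω.map (simpleRefl m)).prod

/-- The Coxeter length: the least number of adjacent transpositions with product `w`. -/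
noncomputable def length {m : ℕ} (w : Perm (Fin m)) : ℕ :=
  sInf {k | ∃ ω : List (Fin (m - 1)), ω.length = k ∧ wordProd ω = w}

theorem exists_word {m : ℕ} (w : Perm (Fin m)) :
    ∃ ω : List (Fin (m - 1)), wordProd ω = w := by
  cases m with
  | zero => exact ⟨[], Subsingleton.elim _ _⟩
  | succ m =>
    have h : w ∈ Submonoid.closure
        (Set.range fun i : Fin m ↦ swap i.castSucc i.succ) := by
      rw [Perm.mclosure_swap_castSucc_succ]; trivial
    induction h using Submonoid.closure_induction with
    | mem x hx =>
      obtain ⟨i, rfl⟩ := hx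
      refine ⟨[i], ?_⟩
      simp only [wordProd, List.map_cons, List.map_nil, List.prod_cons, List.prod_nil, mul_one]
      rfl
    | one => exact ⟨[], rfl⟩
    | mul x y _ _ ihx ihy =>
      obtain ⟨a, rfl⟩ := ihx
      obtain ⟨b, rfl⟩ := ihy
      exact ⟨a ++ b, by simp [wordProd]⟩

theorem exists_reducedWord {m : ℕ} (w : Perm (Fin m)) :
    ∃ ω : List (Fin (m - 1)), ω.length = length w ∧ wordProd ω = w := by
  obtain ⟨ω, hω⟩ := exists_word w
  exact Nat.sInf_mem (s := {k | ∃ ω : List (Fin (m - 1)), ω.length = k ∧ wordProd ω = w})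
    ⟨ω.length, ω, rfl, hω⟩

/-- A reduced word of `w`. -/
noncomputable def reducedWord {m : ℕ} (w : Perm (Fin m)) : List (Fin (m - 1)) :=
  (exists_reducedWord w).choose

open Classical in
/-- The Demazure product `w ∘ s` with an adjacent transposition `s` on the right. -/
noncomputable def demazureSimple {m : ℕ} (w : Perm (Fin m)) (i : Fin (m - 1)) : Perm (Fin m) :=
  if length w < length (w * simpleRefl m i) then w * simpleRefl m i else w

/-- The Demazure product `u ∘ v = (⋯((u ∘ s₁) ∘ s₂) ⋯) ∘ sₖ`, where `v = s₁ s₂ ⋯ sₖ` is a reduced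
expression (the result does not depend on which one). -/
noncomputable def demazure {m : ℕ} (u v : Perm (Fin m)) : Perm (Fin m) :=
  (reducedWord v).foldl demazureSimple u

/-- The Demazure conjugation `w⁻¹ ∘ x ∘ w`. -/
noncomputable def demazureConj {m : ℕ} (x w : Perm (Fin m)) : Perm (Fin m) :=
  demazure (demazure w⁻¹ x) w

/-- The Hecke atoms of `y` relative to `x`. -/
def heckeAtoms {m : ℕ} (x y : Perm (Fin m)) : Set (Perm (Fin m)) :=
  {w | demazureConj x w = y}

/-- The atoms of `y` relative to `x`: the Hecke atoms of minimal length. -/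
def atoms {m : ℕ} (x y : Perm (Fin m)) : Set (Perm (Fin m)) :=
  {w | w ∈ heckeAtoms x y ∧ ∀ v ∈ heckeAtoms x y, length w ≤ length v}

/-- The product of the commuting adjacent transpositions `(1,2), (3,4), …, (2n-1,2n)`. -/
def wFPF (n : ℕ) : Perm (Fin (2 * n)) :=
  wordProd ((List.finRange n).map fun i ↦ ⟨2 * i.1, by omega⟩)

/-- The atoms relative to `(1,2)(3,4)⋯(2n-1,2n)`. -/
def atomsFPF {n : ℕ} (x : Perm (Fin (2 * n))) : Set (Perm (Fin (2 * n))) :=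
  atoms (wFPF n) x

/-- Fixed-point-free involutions. -/
def IsFPFInvolution {m : ℕ} (x : Perm (Fin m)) : Prop :=
  x = x⁻¹ ∧ ∀ i, x i ≠ i

/-- The one-line representation `[w(1), w(2), …, w(m)]` of a permutation, with the usual values in
`{1, …, m}`. -/
def oneLine {m : ℕ} (w : Perm (Fin m)) : List ℤ :=
  List.ofFn fun i ↦ ((w i : ℕ) : ℤ) + 1

/-- The generating relation on integer sequences of even length: an even number of entries, then
`a, d, b, c` replaced by `b, c, a, d` where `a ≤ b ≤ c ≤ d`, then an even number of entries. -/
def FPFStep (l l' : List ℤ) : Prop :=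
  ∃ (α β : List ℤ) (a b c d : ℤ), Even α.length ∧ Even β.length ∧ a ≤ b ∧ b ≤ c ∧ c ≤ d ∧
    l = α ++ [a, d, b, c] ++ β ∧ l' = α ++ [b, c, a, d] ++ β

/-- The relation `≺`: the transitive closure of the generating relation. -/
def FPFLt : List ℤ → List ℤ → Prop := Relation.TransGen FPFStep

/-- The relation `⪯`: equality or `≺`. -/
def FPFLe (l l' : List ℤ) : Prop := l = l' ∨ FPFLt l l'

/-- The cycles of an involution as pairs: `{(a, b) : a ≤ b = x(a)}`. -/
def cyc {m : ℕ} (x : Perm (Fin m)) : Finset (Fin m × Fin m) :=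
  {p | p.1 ≤ p.2 ∧ p.2 = x p.1}

/-- The list `a₁, b₁, a₂, b₂, …` of the cycles `(aᵢ, bᵢ)` with `a₁ < a₂ < ⋯`; here `bᵢ = x(aᵢ)`. -/
def zeroWord {m : ℕ} (x : Perm (Fin m)) : List (Fin m) :=
  (((cyc x).image Prod.fst).sort (· ≤ ·)).flatMap fun a ↦ [a, x a]

/-- The list `c₁, d₁, c₂, d₂, …` of the cycles `(cᵢ, dᵢ)` with `d₁ < d₂ < ⋯`; here `cᵢ = x(dᵢ)`, as
`x` is an involution. -/
def oneWord {m : ℕ} (x : Perm (Fin m)) : List (Fin m) :=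
  (((cyc x).image Prod.snd).sort (· ≤ ·)).flatMap fun d ↦ [x d, d]

theorem IsFPFInvolution.apply_apply {m : ℕ} {x : Perm (Fin m)} (hx : IsFPFInvolution x)
    (i : Fin m) : x (x i) = i := by
  have h := congrArg (fun σ : Perm (Fin m) ↦ σ (x i)) hx.1
  simpa using h

theorem mem_fst {m : ℕ} {x : Perm (Fin m)} {a : Fin m} :
    a ∈ (cyc x).image Prod.fst ↔ a ≤ x a := by
  simp [cyc]

theorem mem_snd {m : ℕ} {x : Perm (Fin m)} (hx : IsFPFInvolution x) {d : Fin m} :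
    d ∈ (cyc x).image Prod.snd ↔ x d ≤ d := by
  simp only [cyc, Finset.mem_image, Finset.mem_filter, Finset.mem_univ, true_and, Prod.exists]
  constructor
  · rintro ⟨a, b, ⟨h1, h2⟩, rfl⟩
    subst h2
    simpa [hx.apply_apply] using h1
  · intro h
    exact ⟨x d, d, ⟨h, (hx.apply_apply d).symm⟩, rfl⟩

theorem mem_zeroWord {m : ℕ} {x : Perm (Fin m)} (hx : IsFPFInvolution x) (i : Fin m) :
    i ∈ zeroWord x := by
  simp only [zeroWord, List.mem_flatMap, Finset.mem_sort, mem_fst, List.mem_cons,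
    List.not_mem_nil, or_false]
  rcases le_total i (x i) with h | h
  · exact ⟨i, h, .inl rfl⟩
  · exact ⟨x i, by rwa [hx.apply_apply], .inr (hx.apply_apply i).symm⟩

theorem mem_oneWord {m : ℕ} {x : Perm (Fin m)} (hx : IsFPFInvolution x) (i : Fin m) :
    i ∈ oneWord x := by
  simp only [oneWord, List.mem_flatMap, Finset.mem_sort, mem_snd hx, List.mem_cons,
    List.not_mem_nil, or_false]
  rcases le_total i (x i) with h | h
  · exact ⟨x i, by rwa [hx.apply_apply], .inl (hx.apply_apply i).symm⟩
  · exact ⟨i, h, .inr rfl⟩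

theorem nodup_zeroWord {m : ℕ} {x : Perm (Fin m)} (hx : IsFPFInvolution x) :
    (zeroWord x).Nodup := by
  rw [zeroWord, List.nodup_flatMap]
  refine ⟨fun a _ ↦ by simpa using (hx.2 a).symm, ?_⟩
  refine List.Pairwise.imp_of_mem ?_ (Finset.sort_nodup _ _)
  intro a b ha hb hab
  rw [Finset.mem_sort, mem_fst] at ha hb
  have h1 := hx.apply_apply a
  have h2 := hx.apply_apply b
  have h3 := hx.2 a
  have h4 := hx.2 b
  simp only [Function.onFun, List.disjoint_left, List.mem_cons, List.not_mem_nil, or_false]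
  grind

theorem nodup_oneWord {m : ℕ} {x : Perm (Fin m)} (hx : IsFPFInvolution x) :
    (oneWord x).Nodup := by
  rw [oneWord, List.nodup_flatMap]
  refine ⟨fun a _ ↦ by simpa using hx.2 a, ?_⟩
  refine List.Pairwise.imp_of_mem ?_ (Finset.sort_nodup _ _)
  intro a b ha hb hab
  rw [Finset.mem_sort, mem_snd hx] at ha hb
  have h1 := hx.apply_apply a
  have h2 := hx.apply_apply b
  have h3 := hx.2 a
  have h4 := hx.2 b
  simp only [Function.onFun, List.disjoint_left, List.mem_cons, List.not_mem_nil, or_false]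
  grind

theorem length_of_nodup {m : ℕ} {l : List (Fin m)} (h : l.Nodup) (h' : ∀ i, i ∈ l) :
    m = l.length := by
  have := Fintype.card_congr (h.getEquivOfForallMemList l h')
  simpa using this.symm

/-- The permutation whose one-line notation is the list `l`. -/
def ofWord {m : ℕ} (l : List (Fin m)) (h : l.Nodup) (h' : ∀ i, i ∈ l) : Perm (Fin m) :=
  (finCongr (length_of_nodup h h')).trans (h.getEquivOfForallMemList l h')

/-- The permutation `0̂(x) = [a₁, b₁, a₂, b₂, …, aₙ, bₙ]`. -/
def hatZero {m : ℕ} (x : Perm (Fin m)) (hx : IsFPFInvolution x) : Perm (Fin m) :=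
  ofWord (zeroWord x) (nodup_zeroWord hx) (mem_zeroWord hx)

/-- The permutation `1̂(x) = [c₁, d₁, c₂, d₂, …, cₙ, dₙ]`. -/
def hatOne {m : ℕ} (x : Perm (Fin m)) (hx : IsFPFInvolution x) : Perm (Fin m) :=
  ofWord (oneWord x) (nodup_oneWord hx) (mem_oneWord hx)

end FPFAtoms

/-! Both descriptions reduce to one condition on `u`: the blocks (u(2i-1), u(2i)) are the cycles of
`x` with smaller entry first, and no block comes after one that is larger in both entries.

Atoms: on a fixed-point-free involution, Demazure conjugation by a simple transposition either is
ordinary conjugation or does nothing, and it adds at most two inversions. So a Hecke atom w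
satisfies inv x ≤ inv w_FPF + 2 inv w. Once some w conjugating w_FPF to `x` attains equality, the
atoms are exactly the conjugators that attain it (`mem_atoms_iff`). For u = w⁻¹, counting inversions
of u w_FPF u⁻¹ by pairs of blocks shows that equality means `Good u` (`inv_conj_eq_iff_good`).

Order: a generating step exchanges two adjacent nested blocks. Neither is smaller in both entries,
so the condition is preserved in both directions (`arranged_iff_of_fpfLe`). Conversely, insertion
sort of an arranged list by first entries moves blocks only past nested ones, so it descends in the
order to the list of `hatZero`; sorting by second entries ascends to that of `hatOne`
(`arranged_iff_sorted_fst_le`, `arranged_iff_le_sorted_snd`). In particular `hatZero` is arranged,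
which shows that the bound is attained. -/

namespace FPFAtoms

open Equiv

/-! ### Inversions and length -/

section Inversions

variable {m : ℕ}

/-- The number of inversions of a permutation. -/
def inv (w : Perm (Fin m)) : ℕ :=
  (Finset.univ.filter fun p : Fin m × Fin m ↦ p.1 < p.2 ∧ w p.2 < w p.1).card

/-- The letter `i`, as the lower of the two letters moved by `simpleRefl m i`. -/
def lo (i : Fin (m - 1)) : Fin m := ⟨i.1, by omega⟩

/-- The letter `i + 1`, as the upper of the two letters moved by `simpleRefl m i`. -/
def hi (i : Fin (m - 1)) : Fin m := ⟨i.1 + 1, by omega⟩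

theorem lo_lt_hi (i : Fin (m - 1)) : lo i < hi i := by simp [lo, hi, Fin.lt_def]

theorem simpleRefl_eq (i : Fin (m - 1)) : simpleRefl m i = swap (lo i) (hi i) := rfl

@[simp] theorem simpleRefl_lo (i : Fin (m - 1)) : simpleRefl m i (lo i) = hi i := by
  simp [simpleRefl_eq]

@[simp] theorem simpleRefl_hi (i : Fin (m - 1)) : simpleRefl m i (hi i) = lo i := by
  simp [simpleRefl_eq]

@[simp] theorem simpleRefl_mul_self (i : Fin (m - 1)) : simpleRefl m i * simpleRefl m i = 1 := by
  simp [simpleRefl_eq]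

@[simp] theorem simpleRefl_inv (i : Fin (m - 1)) : (simpleRefl m i)⁻¹ = simpleRefl m i := by
  simp [simpleRefl_eq]

@[simp] theorem simpleRefl_apply_apply (i : Fin (m - 1)) (p : Fin m) :
    simpleRefl m i (simpleRefl m i p) = p := by
  simp [simpleRefl_eq]

/-- No letter lies strictly between `lo i` and `hi i`, so exchanging them reverses no other pair. -/
theorem simpleRefl_lt {i : Fin (m - 1)} {p q : Fin m} (h : p < q)
    (hne : ¬ (p = lo i ∧ q = hi i)) : simpleRefl m i p < simpleRefl m i q := by
  simp only [simpleRefl_eq, swap_apply_def, lo, hi, Fin.ext_iff, Fin.lt_def] at *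
  split_ifs <;> simp_all <;> omega

/-- Moving positions by the transposition carries the old inversions to new ones; the only further
inversion is the pair (`lo i`, `hi i`). -/
theorem inv_mul_of_lt {w : Perm (Fin m)} {i : Fin (m - 1)} (h : w (lo i) < w (hi i)) :
    inv (w * simpleRefl m i) = inv w + 1 := by
  have key : (Finset.univ.filter fun p : Fin m × Fin m ↦
        p.1 < p.2 ∧ (w * simpleRefl m i) p.2 < (w * simpleRefl m i) p.1) =
      insert (lo i, hi i) ((Finset.univ.filter fun p : Fin m × Fin m ↦
        p.1 < p.2 ∧ w p.2 < w p.1).map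
          ((simpleRefl m i).prodCongr (simpleRefl m i)).toEmbedding) := by
    ext ⟨p, q⟩
    simp only [Finset.mem_filter, Finset.mem_univ, true_and, Finset.mem_insert,
      Finset.mem_map_equiv, Prod.mk.injEq]
    simp only [Perm.mul_apply]
    have hs : (((simpleRefl m i).prodCongr (simpleRefl m i)).symm (p, q)) =
        (simpleRefl m i p, simpleRefl m i q) := by
      simp [simpleRefl_eq]
    rw [hs]
    by_cases hpq : p = lo i ∧ q = hi i
    · obtain ⟨rfl, rfl⟩ := hpq
      simp [h, lo_lt_hi]
    · simp only [hpq, false_or]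
      refine and_congr_left fun hw ↦ ⟨fun hlt ↦ simpleRefl_lt hlt hpq, fun hlt ↦ ?_⟩
      have := simpleRefl_lt (i := i) hlt ?_
      · simpa using this
      · rintro ⟨h1, h2⟩
        rw [h1, h2] at hw
        exact absurd hw h.not_gt
  rw [inv, key, Finset.card_insert_of_notMem, Finset.card_map, inv]
  simp only [Finset.mem_map_equiv, Finset.mem_filter, Finset.mem_univ, true_and]
  simp [simpleRefl_eq, (lo_lt_hi i).le]

theorem inv_mul_of_gt {w : Perm (Fin m)} {i : Fin (m - 1)} (h : w (hi i) < w (lo i)) :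
    inv (w * simpleRefl m i) + 1 = inv w := by
  have := inv_mul_of_lt (w := w * simpleRefl m i) (i := i) (by simpa using h)
  rw [mul_assoc, simpleRefl_mul_self, mul_one] at this
  exact this.symm

theorem apply_lo_lt_or_gt (w : Perm (Fin m)) (i : Fin (m - 1)) :
    w (lo i) < w (hi i) ∨ w (hi i) < w (lo i) :=
  lt_or_gt_of_ne fun h ↦ (lo_lt_hi i).ne (w.injective h)

theorem inv_mul_le (w : Perm (Fin m)) (i : Fin (m - 1)) :
    inv (w * simpleRefl m i) ≤ inv w + 1 := by
  rcases apply_lo_lt_or_gt w i with h | h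
  · exact (inv_mul_of_lt h).le
  · have := inv_mul_of_gt h; omega

theorem inv_one : inv (1 : Perm (Fin m)) = 0 := by
  rw [inv, Finset.card_eq_zero, Finset.filter_eq_empty_iff]
  intro p _ h
  exact absurd h.1 h.2.not_gt

theorem inv_inv (w : Perm (Fin m)) : inv w⁻¹ = inv w := by
  refine Finset.card_bij' (fun p _ ↦ (w⁻¹ p.2, w⁻¹ p.1)) (fun p _ ↦ (w p.2, w p.1)) ?_ ?_ ?_ ?_
  · simp +contextual
  · simp +contextual
  · simp
  · simp

theorem eq_one_of_forall_lt {w : Perm (Fin m)} (h : ∀ i, w (lo i) < w (hi i)) : w = 1 := by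
  cases m with
  | zero => exact Subsingleton.elim _ _
  | succ m =>
    have h1 : StrictMono w := Fin.strictMono_iff_lt_succ.2 fun i ↦ h i
    ext i
    have := h1.range_inj strictMono_id
    rw [this.1 (by simp [w.surjective.range_eq])]
    rfl

theorem wordProd_append (ω ω' : List (Fin (m - 1))) :
    wordProd (ω ++ ω') = wordProd ω * wordProd ω' := by
  simp [wordProd]

theorem wordProd_cons (i : Fin (m - 1)) (ω : List (Fin (m - 1))) :
    wordProd (i :: ω) = simpleRefl m i * wordProd ω := by
  simp [wordProd]

theorem inv_wordProd_le (ω : List (Fin (m - 1))) : inv (wordProd ω) ≤ ω.length := by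
  induction ω using List.reverseRecOn with
  | nil => simp [wordProd, inv_one]
  | append_singleton ω i ih =>
    rw [wordProd_append]
    have := inv_mul_le (wordProd ω) i
    simp only [wordProd, List.map_cons, List.map_nil, List.prod_cons, List.prod_nil, mul_one,
      List.length_append, List.length_cons, List.length_nil] at *
    omega

/-- Bubble sort: a permutation other than 1 has a descent, and removing it costs one letter and one
inversion. -/
theorem exists_word_of_inv_eq (k : ℕ) (w : Perm (Fin m)) (h : inv w = k) :
    ∃ ω : List (Fin (m - 1)), ω.length = k ∧ wordProd ω = w := by
  induction k generalizing w with
  | zero =>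
    refine ⟨[], rfl, (eq_one_of_forall_lt fun i ↦ ?_).symm⟩
    refine (apply_lo_lt_or_gt w i).resolve_right fun hlt ↦ ?_
    have := inv_mul_of_gt hlt
    omega
  | succ k ih =>
    obtain ⟨i, hlt⟩ : ∃ i, w (hi i) < w (lo i) := by
      by_contra! hcon
      have : w = 1 := eq_one_of_forall_lt fun i ↦
        (apply_lo_lt_or_gt w i).resolve_right (hcon i).not_gt
      rw [this, inv_one] at h
      omega
    obtain ⟨ω, h1, h2⟩ := ih (w * simpleRefl m i) (by have := inv_mul_of_gt hlt; omega)
    refine ⟨ω ++ [i], by simp [h1], ?_⟩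
    rw [wordProd_append, h2]
    simp [wordProd, mul_assoc]

theorem length_eq_inv (w : Perm (Fin m)) : length w = inv w := by
  apply le_antisymm
  · exact Nat.sInf_le (exists_word_of_inv_eq _ w rfl)
  · obtain ⟨ω, h1, h2⟩ := exists_reducedWord w
    rw [← h1, ← h2]
    exact inv_wordProd_le ω

theorem reducedWord_length (w : Perm (Fin m)) : (reducedWord w).length = inv w := by
  rw [← length_eq_inv]; exact (exists_reducedWord w).choose_spec.1

theorem wordProd_reducedWord (w : Perm (Fin m)) : wordProd (reducedWord w) = w :=
  (exists_reducedWord w).choose_spec.2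

theorem demazureSimple_of_lt {w : Perm (Fin m)} {i : Fin (m - 1)} (h : w (lo i) < w (hi i)) :
    demazureSimple w i = w * simpleRefl m i := by
  rw [demazureSimple, if_pos]
  rw [length_eq_inv, length_eq_inv, inv_mul_of_lt h]
  omega

theorem demazureSimple_of_gt {w : Perm (Fin m)} {i : Fin (m - 1)} (h : w (hi i) < w (lo i)) :
    demazureSimple w i = w := by
  rw [demazureSimple, if_neg]
  have := inv_mul_of_gt h
  rw [length_eq_inv, length_eq_inv]
  omega

end Inversions

/-! ### Demazure conjugation along a word -/

section Conjugation

variable {m : ℕ}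

/-- The Demazure product `s ∘ w` with an adjacent transposition `s` on the left. -/
noncomputable def demazureLeft (w : Perm (Fin m)) (i : Fin (m - 1)) : Perm (Fin m) :=
  (demazureSimple w⁻¹ i)⁻¹

theorem demazureLeft_of_lt {w : Perm (Fin m)} {i : Fin (m - 1)}
    (h : w⁻¹ (lo i) < w⁻¹ (hi i)) : demazureLeft w i = simpleRefl m i * w := by
  rw [demazureLeft, demazureSimple_of_lt h]; simp

theorem demazureLeft_of_gt {w : Perm (Fin m)} {i : Fin (m - 1)}
    (h : w⁻¹ (hi i) < w⁻¹ (lo i)) : demazureLeft w i = w := by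
  rw [demazureLeft, demazureSimple_of_gt h]; simp

/-- The two sides interfere only if `w` maps `lo j`, `hi j` to `lo i`, `hi i`. Then s_i w = w s_j,
and whichever product is taken first makes the other idle. This commutation does the work of
associativity. -/
theorem demazure_left_right_comm (w : Perm (Fin m)) (i j : Fin (m - 1)) :
    demazureLeft (demazureSimple w j) i = demazureSimple (demazureLeft w i) j := by
  rcases apply_lo_lt_or_gt w j with hR | hR <;> rcases apply_lo_lt_or_gt w⁻¹ i with hL | hL
  · rw [demazureSimple_of_lt hR, demazureLeft_of_lt hL]
    by_cases hc : w⁻¹ (lo i) = lo j ∧ w⁻¹ (hi i) = hi j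
    · have h1 : w (lo j) = lo i := by rw [← hc.1]; simp
      have h2 : w (hi j) = hi i := by rw [← hc.2]; simp
      rw [demazureLeft_of_gt, demazureSimple_of_gt]
      · rw [simpleRefl_eq, simpleRefl_eq, ← h1, ← h2, mul_swap_eq_swap_mul]
      · simp [h1, h2, lo_lt_hi]
      · rw [mul_inv_rev, Perm.mul_apply, Perm.mul_apply, hc.1, hc.2]
        simp [lo_lt_hi]
    · have hc' : ¬ (w (lo j) = lo i ∧ w (hi j) = hi i) := by
        rintro ⟨h1, h2⟩
        exact hc ⟨by rw [← h1]; simp, by rw [← h2]; simp⟩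
      rw [demazureLeft_of_lt, demazureSimple_of_lt, mul_assoc]
      · exact simpleRefl_lt hR hc'
      · simpa using simpleRefl_lt hL hc
  · rw [demazureSimple_of_lt hR, demazureLeft_of_gt hL, demazureSimple_of_lt hR,
      demazureLeft_of_gt]
    have := simpleRefl_lt (i := j) hL ?_
    · simpa using this
    · rintro ⟨h1, h2⟩
      rw [← h1, ← h2] at hR
      simp only [Perm.inv_def, apply_symm_apply] at hR
      exact absurd hR (lo_lt_hi i).not_gt
  · rw [demazureSimple_of_gt hR, demazureLeft_of_lt hL, demazureSimple_of_gt]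
    refine simpleRefl_lt hR ?_
    rintro ⟨h1, h2⟩
    rw [← h1, ← h2] at hL
    simp only [Perm.inv_def, symm_apply_apply] at hL
    exact absurd hL (lo_lt_hi j).not_gt
  · rw [demazureSimple_of_gt hR, demazureLeft_of_gt hL, demazureSimple_of_gt hR]

theorem foldl_demazureSimple_left (w : Perm (Fin m)) (i : Fin (m - 1))
    (ω : List (Fin (m - 1))) :
    ω.foldl demazureSimple (demazureLeft w i) = demazureLeft (ω.foldl demazureSimple w) i := by
  induction ω generalizing w with
  | nil => rfl
  | cons j ω ih => rw [List.foldl_cons, List.foldl_cons, ← demazure_left_right_comm, ih]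

theorem foldl_demazureSimple_foldl_left (w : Perm (Fin m)) (ω ω' : List (Fin (m - 1))) :
    ω.foldl demazureSimple (ω'.foldl demazureLeft w) =
      ω'.foldl demazureLeft (ω.foldl demazureSimple w) := by
  induction ω' generalizing w with
  | nil => rfl
  | cons j ω' ih => rw [List.foldl_cons, List.foldl_cons, ih, foldl_demazureSimple_left]

/-- Prefixes of a reduced word are reduced, so no step is idle. -/
theorem foldl_demazureSimple_one {ω : List (Fin (m - 1))} (h : ω.length = inv (wordProd ω)) :
    ω.foldl demazureSimple 1 = wordProd ω := by
  induction ω using List.reverseRecOn with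
  | nil => simp [wordProd]
  | append_singleton ω i ih =>
    have hp : wordProd (ω ++ [i]) = wordProd ω * simpleRefl m i := by
      simp [wordProd]
    have h1 := inv_wordProd_le ω
    have h2 := inv_mul_le (wordProd ω) i
    rw [hp, List.length_append, List.length_singleton] at h
    rw [List.foldl_append, ih (by omega), hp, List.foldl_cons, List.foldl_nil]
    refine demazureSimple_of_lt ((apply_lo_lt_or_gt _ i).resolve_right fun hlt ↦ ?_)
    have := inv_mul_of_gt hlt
    omega

theorem foldl_demazureLeft (w : Perm (Fin m)) (ω : List (Fin (m - 1))) :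
    ω.foldl demazureLeft w = (ω.foldl demazureSimple w⁻¹)⁻¹ := by
  induction ω generalizing w with
  | nil => simp
  | cons i ω ih => rw [List.foldl_cons, List.foldl_cons, ih, demazureLeft, _root_.inv_inv]

/-- The Demazure conjugation `s ∘ w ∘ s` by an adjacent transposition `s`. -/
noncomputable def demazureConjSimple (w : Perm (Fin m)) (i : Fin (m - 1)) : Perm (Fin m) :=
  demazureSimple (demazureLeft w i) i

theorem foldl_demazureConjSimple (w : Perm (Fin m)) (ω : List (Fin (m - 1))) :
    ω.foldl demazureSimple (ω.foldl demazureLeft w) = ω.foldl demazureConjSimple w := by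
  induction ω generalizing w with
  | nil => rfl
  | cons i ω ih =>
    have := foldl_demazureSimple_foldl_left (demazureLeft w i) [i] ω
    simp only [List.foldl_cons, List.foldl_nil] at this ⊢
    rw [this, ih, demazureConjSimple]

/-- Build `w⁻¹` from 1 by left products and pull these outside the right products that build `x`;
the left and right products by each letter of `w` then pair up. -/
theorem demazureConj_eq_foldl (x w : Perm (Fin m)) :
    demazureConj x w = (reducedWord w).foldl demazureConjSimple x := by
  have hw : w⁻¹ = (reducedWord w).foldl demazureLeft 1 := by
    rw [foldl_demazureLeft, _root_.inv_one, foldl_demazureSimple_one, wordProd_reducedWord]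
    rw [wordProd_reducedWord, reducedWord_length]
  have hx : (reducedWord x).foldl demazureSimple 1 = x := by
    rw [foldl_demazureSimple_one, wordProd_reducedWord]
    rw [wordProd_reducedWord, reducedWord_length]
  rw [demazureConj, demazure, demazure, ← foldl_demazureConjSimple]
  nth_rw 1 [hw]
  rw [foldl_demazureSimple_foldl_left, hx]

/-! ### Demazure conjugation of fixed-point-free involutions -/

theorem IsFPFInvolution.inv_apply {y : Perm (Fin m)} (hy : IsFPFInvolution y) (i : Fin m) :
    y⁻¹ i = y i := by rw [← hy.1]

theorem IsFPFInvolution.conj {y : Perm (Fin m)} (hy : IsFPFInvolution y) (u : Perm (Fin m)) :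
    IsFPFInvolution (u * y * u⁻¹) := by
  refine ⟨by simp [mul_assoc, ← hy.1], fun i h ↦ hy.2 (u⁻¹ i) ?_⟩
  rw [Perm.mul_apply, Perm.mul_apply] at h
  rw [Perm.eq_inv_iff_eq, h]

/-- The right product could be idle after the left one only if `y` fixed both letters. Hence s ∘ y ∘
s never degenerates to a one-sided product. -/
theorem IsFPFInvolution.conj_lt {y : Perm (Fin m)} (hy : IsFPFInvolution y)
    {i : Fin (m - 1)} (h : y (lo i) < y (hi i)) :
    (simpleRefl m i * y) (lo i) < (simpleRefl m i * y) (hi i) := by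
  refine simpleRefl_lt h ?_
  rintro ⟨h1, -⟩
  exact hy.2 _ h1

theorem demazureConjSimple_of_lt {y : Perm (Fin m)} (hy : IsFPFInvolution y)
    {i : Fin (m - 1)} (h : y (lo i) < y (hi i)) :
    demazureConjSimple y i = simpleRefl m i * y * simpleRefl m i := by
  rw [demazureConjSimple, demazureLeft_of_lt (by simpa only [hy.inv_apply] using h),
    demazureSimple_of_lt (hy.conj_lt h)]

theorem demazureConjSimple_of_gt {y : Perm (Fin m)} (hy : IsFPFInvolution y)
    {i : Fin (m - 1)} (h : y (hi i) < y (lo i)) : demazureConjSimple y i = y := by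
  rw [demazureConjSimple, demazureLeft_of_gt (by simpa only [hy.inv_apply] using h),
    demazureSimple_of_gt h]

theorem inv_simpleRefl_mul (w : Perm (Fin m)) (i : Fin (m - 1)) :
    inv (simpleRefl m i * w) = inv (w⁻¹ * simpleRefl m i) := by
  rw [← inv_inv, mul_inv_rev, simpleRefl_inv]

theorem inv_conj_simple_le (y : Perm (Fin m)) (i : Fin (m - 1)) :
    inv (simpleRefl m i * y * simpleRefl m i) ≤ inv y + 2 := by
  have h1 := inv_mul_le (simpleRefl m i * y) i
  have h2 := inv_mul_le y⁻¹ i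
  rw [inv_simpleRefl_mul] at h1
  rw [inv_inv] at h2
  omega

/-- At a descent the left factor removes an inversion and the right one restores at most one. -/
theorem inv_conj_simple_of_gt {y : Perm (Fin m)} (hy : IsFPFInvolution y)
    {i : Fin (m - 1)} (h : y (hi i) < y (lo i)) :
    inv (simpleRefl m i * y * simpleRefl m i) ≤ inv y := by
  have h1 := inv_mul_le (simpleRefl m i * y) i
  have h2 := inv_mul_of_gt (w := y⁻¹) (i := i) (by simpa only [hy.inv_apply] using h)
  rw [inv_simpleRefl_mul] at h1
  rw [inv_inv] at h2
  omega

theorem conj_wordProd_cons (y : Perm (Fin m)) (i : Fin (m - 1)) (ω : List (Fin (m - 1))) :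
    (wordProd (i :: ω))⁻¹ * y * wordProd (i :: ω) =
      (wordProd ω)⁻¹ * (simpleRefl m i * y * simpleRefl m i) * wordProd ω := by
  simp [wordProd_cons, mul_assoc]

theorem inv_conj_wordProd_le (y : Perm (Fin m)) (ω : List (Fin (m - 1))) :
    inv ((wordProd ω)⁻¹ * y * wordProd ω) ≤ inv y + 2 * ω.length := by
  induction ω generalizing y with
  | nil => simp [wordProd]
  | cons i ω ih =>
    have h1 := ih (simpleRefl m i * y * simpleRefl m i)
    have h2 := inv_conj_simple_le y i
    rw [conj_wordProd_cons, List.length_cons]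
    omega

theorem IsFPFInvolution.conj_simple {y : Perm (Fin m)} (hy : IsFPFInvolution y)
    (i : Fin (m - 1)) : IsFPFInvolution (simpleRefl m i * y * simpleRefl m i) := by
  simpa using hy.conj (simpleRefl m i)

theorem inv_foldl_demazureConjSimple_le {y : Perm (Fin m)} (hy : IsFPFInvolution y)
    (ω : List (Fin (m - 1))) :
    inv (ω.foldl demazureConjSimple y) ≤ inv y + 2 * ω.length := by
  induction ω generalizing y with
  | nil => simp
  | cons i ω ih =>
    rw [List.foldl_cons, List.length_cons]
    rcases apply_lo_lt_or_gt y i with h | h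
    · rw [demazureConjSimple_of_lt hy h]
      have h1 := ih (hy.conj_simple i)
      have h2 := inv_conj_simple_le y i
      omega
    · rw [demazureConjSimple_of_gt hy h]
      have h1 := ih hy
      omega

/-- An idle step wastes a letter, and the rest gain at most two inversions each; so at equality
every step is a genuine conjugation. -/
theorem foldl_demazureConjSimple_of_inv_eq {y : Perm (Fin m)} (hy : IsFPFInvolution y)
    {ω : List (Fin (m - 1))}
    (h : inv (ω.foldl demazureConjSimple y) = inv y + 2 * ω.length) :
    ω.foldl demazureConjSimple y = (wordProd ω)⁻¹ * y * wordProd ω := by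
  induction ω generalizing y with
  | nil => simp [wordProd]
  | cons i ω ih =>
    rw [List.foldl_cons, List.length_cons] at h
    rw [List.foldl_cons, conj_wordProd_cons]
    rcases apply_lo_lt_or_gt y i with hlt | hlt
    · rw [demazureConjSimple_of_lt hy hlt] at h ⊢
      have h1 := inv_foldl_demazureConjSimple_le (hy.conj_simple i) ω
      have h2 := inv_conj_simple_le y i
      exact ih (hy.conj_simple i) (by omega)
    · rw [demazureConjSimple_of_gt hy hlt] at h
      have h1 := inv_foldl_demazureConjSimple_le hy ω
      omega

/-- Conversely, ordinary conjugation at a descent gains nothing, so at equality descents never occur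
and Demazure conjugation takes the same steps. -/
theorem foldl_demazureConjSimple_of_inv_conj_eq {y : Perm (Fin m)} (hy : IsFPFInvolution y)
    {ω : List (Fin (m - 1))}
    (h : inv ((wordProd ω)⁻¹ * y * wordProd ω) = inv y + 2 * ω.length) :
    ω.foldl demazureConjSimple y = (wordProd ω)⁻¹ * y * wordProd ω := by
  induction ω generalizing y with
  | nil => simp [wordProd]
  | cons i ω ih =>
    rw [conj_wordProd_cons, List.length_cons] at h
    rw [List.foldl_cons, conj_wordProd_cons]
    have h1 := inv_conj_wordProd_le (simpleRefl m i * y * simpleRefl m i) ω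
    rcases apply_lo_lt_or_gt y i with hlt | hlt
    · rw [demazureConjSimple_of_lt hy hlt]
      have h2 := inv_conj_simple_le y i
      exact ih (hy.conj_simple i) (by omega)
    · have h2 := inv_conj_simple_of_gt hy hlt
      omega

/-- If some `w` attains the bound `inv x = inv y + 2 * inv w`, then the atoms are precisely the
elements that attain it and conjugate `y` to `x`. -/
theorem mem_atoms_iff {x y : Perm (Fin m)} (hy : IsFPFInvolution y)
    (hex : ∃ w : Perm (Fin m), w⁻¹ * y * w = x ∧ inv x = inv y + 2 * inv w)
    (w : Perm (Fin m)) :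
    w ∈ atoms y x ↔ w⁻¹ * y * w = x ∧ inv x = inv y + 2 * inv w := by
  have hle : ∀ v ∈ heckeAtoms y x, inv x ≤ inv y + 2 * inv v := by
    intro v hv
    have hv' : demazureConj y v = x := hv
    rw [← hv', demazureConj_eq_foldl, ← reducedWord_length v]
    exact inv_foldl_demazureConjSimple_le hy _
  have hmem : ∀ v : Perm (Fin m), v⁻¹ * y * v = x → inv x = inv y + 2 * inv v →
      v ∈ heckeAtoms y x := by
    intro v h1 h2
    change demazureConj y v = x
    rw [demazureConj_eq_foldl, foldl_demazureConjSimple_of_inv_conj_eq hy] <;>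
      simp only [wordProd_reducedWord, reducedWord_length, h1, h2]
  constructor
  · rintro ⟨hw, hmin⟩
    obtain ⟨v, hv1, hv2⟩ := hex
    -- Minimality against the extremal `v` gives the inequality opposite to `hle`.
    have h1 := hmin v (hmem v hv1 hv2)
    rw [length_eq_inv, length_eq_inv] at h1
    have h2 := hle w hw
    have h3 : inv x = inv y + 2 * inv w := by omega
    refine ⟨?_, h3⟩
    have hw' : demazureConj y w = x := hw
    rw [demazureConj_eq_foldl] at hw'
    have h4 := foldl_demazureConjSimple_of_inv_eq hy (ω := reducedWord w)
      (by rw [hw', reducedWord_length, h3])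
    rw [hw', wordProd_reducedWord] at h4
    exact h4.symm
  · rintro ⟨h1, h2⟩
    refine ⟨hmem w h1 h2, fun v hv ↦ ?_⟩
    have := hle v hv
    rw [length_eq_inv, length_eq_inv]
    omega

end Conjugation

/-! ### Inversions of fixed-point-free involutions, counted by blocks -/

section Blocks

variable {n : ℕ}

/-- The position of the first entry of block `i`. -/
def ev (i : Fin n) : Fin (2 * n) := ⟨2 * i.1, by omega⟩

/-- The position of the second entry of block `i`. -/
def od (i : Fin n) : Fin (2 * n) := ⟨2 * i.1 + 1, by omega⟩

@[simp] theorem ev_ne_od (i j : Fin n) : ev i ≠ od j := by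
  simp only [ev, od, ne_eq, Fin.ext_iff]; omega

@[simp] theorem od_ne_ev (i j : Fin n) : od i ≠ ev j := (ev_ne_od j i).symm

@[simp] theorem ev_inj {i j : Fin n} : ev i = ev j ↔ i = j := by
  simp only [ev, Fin.ext_iff]; omega

@[simp] theorem od_inj {i j : Fin n} : od i = od j ↔ i = j := by
  simp only [od, Fin.ext_iff]; omega

theorem eq_ev_or_od (r : Fin (2 * n)) : ∃ i, r = ev i ∨ r = od i := by
  refine ⟨⟨r.1 / 2, by omega⟩, ?_⟩
  simp only [ev, od, Fin.ext_iff]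
  omega

theorem sum_blocks (F : Fin (2 * n) → ℕ) : ∑ r, F r = ∑ i, (F (ev i) + F (od i)) := by
  induction n with
  | zero => simp
  | succ n ih =>
    rw [Fin.sum_univ_castSucc (n := n)]
    have h := Fin.sum_univ_castSucc (n := 2 * n + 1) F
    rw [Fin.sum_univ_castSucc (n := 2 * n)] at h
    refine h.trans ?_
    rw [ih, add_assoc]
    rfl

theorem prod_swap_apply (l : List (Fin n)) (hl : l.Nodup) (j : Fin n) :
    ((l.map fun i ↦ swap (ev i) (od i)).prod (ev j) = if j ∈ l then od j else ev j) ∧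
      ((l.map fun i ↦ swap (ev i) (od i)).prod (od j) = if j ∈ l then ev j else od j) := by
  induction l with
  | nil => simp
  | cons i l ih =>
    obtain ⟨hi, hl⟩ := List.nodup_cons.1 hl
    obtain ⟨h1, h2⟩ := ih hl
    simp only [List.map_cons, List.prod_cons, Perm.mul_apply, h1, h2, List.mem_cons]
    by_cases hj : j = i
    · subst hj
      simp [hi]
    · by_cases hjl : j ∈ l <;> simp [hj, hjl, swap_apply_def]

theorem wFPF_eq (n : ℕ) :
    wFPF n = ((List.finRange n).map fun i ↦ swap (ev i) (od i)).prod := by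
  rw [wFPF, wordProd, List.map_map]
  rfl

@[simp] theorem wFPF_ev (i : Fin n) : wFPF n (ev i) = od i := by
  simp [wFPF_eq, (prod_swap_apply _ (List.nodup_finRange n) i).1]

@[simp] theorem wFPF_od (i : Fin n) : wFPF n (od i) = ev i := by
  simp [wFPF_eq, (prod_swap_apply _ (List.nodup_finRange n) i).2]

theorem isFPFInvolution_wFPF (n : ℕ) : IsFPFInvolution (wFPF n) := by
  refine ⟨?_, fun r ↦ ?_⟩
  · refine eq_inv_of_mul_eq_one_left (Equiv.ext fun r ↦ ?_)
    obtain ⟨i, rfl | rfl⟩ := eq_ev_or_od r <;> simp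
  · obtain ⟨i, rfl | rfl⟩ := eq_ev_or_od r <;> simp

/-- Every block of `u` is increasing, and no block is preceded by a block that is larger in both
entries. -/
def Good (u : Perm (Fin (2 * n))) : Prop :=
  (∀ i, u (ev i) < u (od i)) ∧
    ∀ i j, i < j → ¬ (u (ev j) < u (ev i) ∧ u (od j) < u (od i))

/-- The number of ordered pairs in block `i` times block `j` that the blockwise flip inverts. -/
def flipInv (u : Perm (Fin (2 * n))) (i j : Fin n) : ℕ :=
  (if u (ev i) < u (ev j) ∧ u (od j) < u (od i) then 1 else 0) +
    (if u (ev i) < u (od j) ∧ u (ev j) < u (od i) then 1 else 0) +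
    ((if u (od i) < u (ev j) ∧ u (od j) < u (ev i) then 1 else 0) +
    (if u (od i) < u (od j) ∧ u (ev j) < u (ev i) then 1 else 0))

/-- The number of inversions of `u` with first position in block `i` and second in block `j`. -/
def blockInv (u : Perm (Fin (2 * n))) (i j : Fin n) : ℕ :=
  (if ev i < ev j ∧ u (ev j) < u (ev i) then 1 else 0) +
    (if ev i < od j ∧ u (od j) < u (ev i) then 1 else 0) +
    ((if od i < ev j ∧ u (ev j) < u (od i) then 1 else 0) +
    (if od i < od j ∧ u (od j) < u (od i) then 1 else 0))

theorem inv_eq_sum {m : ℕ} (w : Perm (Fin m)) :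
    inv w = ∑ r, ∑ s, if r < s ∧ w s < w r then 1 else 0 := by
  rw [inv, Finset.card_filter, Fintype.sum_prod_type]

theorem inv_eq_sum_blockInv (u : Perm (Fin (2 * n))) : inv u = ∑ i, ∑ j, blockInv u i j := by
  rw [inv_eq_sum, sum_blocks]
  refine Finset.sum_congr rfl fun i _ ↦ ?_
  rw [sum_blocks, sum_blocks, ← Finset.sum_add_distrib]
  rfl

/-- Index the letters by their positions in `u`; the conjugate then exchanges the two entries of
each block. -/
theorem inv_conj_eq_sum_flipInv (u : Perm (Fin (2 * n))) :
    inv (u * wFPF n * u⁻¹) = ∑ i, ∑ j, flipInv u i j := by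
  rw [inv_eq_sum, ← Equiv.sum_comp u, sum_blocks]
  refine Finset.sum_congr rfl fun i _ ↦ ?_
  rw [← Finset.sum_add_distrib, ← Equiv.sum_comp u, sum_blocks]
  refine Finset.sum_congr rfl fun j _ ↦ ?_
  simp only [Perm.mul_apply, Perm.inv_def, symm_apply_apply, wFPF_ev, wFPF_od, flipInv]
  ring

/-- Only the four comparisons between an entry of (a, b) and one of (c, d) matter, so this is a
finite check. -/
theorem flip_count_le {a b c d : ℕ} (hac : a ≠ c) (had : a ≠ d) (hbc : b ≠ c) (hbd : b ≠ d) :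
    ((if a < c ∧ d < b then 1 else 0) + (if a < d ∧ c < b then 1 else 0) +
      ((if b < c ∧ d < a then 1 else 0) + (if b < d ∧ c < a then 1 else 0))) +
    ((if c < a ∧ b < d then 1 else 0) + (if c < b ∧ a < d then 1 else 0) +
      ((if d < a ∧ b < c then 1 else 0) + (if d < b ∧ a < c then 1 else 0))) ≤
    2 * ((if c < a then 1 else 0) + (if d < a then 1 else 0) +
      ((if c < b then 1 else 0) + (if d < b then 1 else 0))) := by
  have key : ∀ {p q : ℕ}, p ≠ q → (p < q ∧ ¬ q < p) ∨ (¬ p < q ∧ q < p) := by omega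
  rcases key hac with h1 | h1 <;> rcases key had with h2 | h2 <;>
    rcases key hbc with h3 | h3 <;> rcases key hbd with h4 | h4 <;>
    simp [h1, h2, h3, h4]

theorem flip_count_eq_iff {a b c d : ℕ} (hac : a ≠ c) (had : a ≠ d) (hbc : b ≠ c) (hbd : b ≠ d)
    (hab : a < b) (hcd : c < d) :
    ((if a < c ∧ d < b then 1 else 0) + (if a < d ∧ c < b then 1 else 0) +
      ((if b < c ∧ d < a then 1 else 0) + (if b < d ∧ c < a then 1 else 0))) +
    ((if c < a ∧ b < d then 1 else 0) + (if c < b ∧ a < d then 1 else 0) +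
      ((if d < a ∧ b < c then 1 else 0) + (if d < b ∧ a < c then 1 else 0))) =
    2 * ((if c < a then 1 else 0) + (if d < a then 1 else 0) +
      ((if c < b then 1 else 0) + (if d < b then 1 else 0))) ↔ ¬ (c < a ∧ d < b) := by
  have key : ∀ {p q : ℕ}, p ≠ q → (p < q ∧ ¬ q < p) ∨ (¬ p < q ∧ q < p) := by omega
  rcases key hac with h1 | h1 <;> rcases key had with h2 | h2 <;>
    rcases key hbc with h3 | h3 <;> rcases key hbd with h4 | h4 <;>
    first
      | omega
      | simp [h1, h2, h3, h4]

theorem blockInv_of_lt (u : Perm (Fin (2 * n))) {i j : Fin n} (h : i < j) :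
    blockInv u i j + blockInv u j i =
      (if u (ev j) < u (ev i) then 1 else 0) + (if u (od j) < u (ev i) then 1 else 0) +
      ((if u (ev j) < u (od i) then 1 else 0) + (if u (od j) < u (od i) then 1 else 0)) := by
  have e1 : ev i < ev j ∧ ¬ ev j < ev i := by simp only [ev, Fin.lt_def] at *; omega
  have e2 : ev i < od j ∧ ¬ od j < ev i := by simp only [ev, od, Fin.lt_def] at *; omega
  have e3 : od i < ev j ∧ ¬ ev j < od i := by simp only [ev, od, Fin.lt_def] at *; omega
  have e4 : od i < od j ∧ ¬ od j < od i := by simp only [od, Fin.lt_def] at *; omega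
  simp only [blockInv, e1, e2, e3, e4, true_and, false_and, if_false, add_zero]

theorem blockInv_self (u : Perm (Fin (2 * n))) (i : Fin n) :
    blockInv u i i = if u (od i) < u (ev i) then 1 else 0 := by
  have e : ev i < od i ∧ ¬ od i < ev i := by simp only [ev, od, Fin.lt_def]; omega
  simp [blockInv, e]

theorem flipInv_self (u : Perm (Fin (2 * n))) (i : Fin n) : flipInv u i i = 1 := by
  rcases lt_or_gt_of_ne (u.injective.ne (ev_ne_od i i)) with h | h <;>
    simp [flipInv, h, h.not_gt]

theorem apply_val_ne (u : Perm (Fin (2 * n))) {r s : Fin (2 * n)} (h : r ≠ s) :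
    (u r : ℕ) ≠ u s := fun h' ↦ h (u.injective (Fin.ext h'))

theorem flipInv_le_of_lt (u : Perm (Fin (2 * n))) {i j : Fin n} (h : i < j) :
    flipInv u i j + flipInv u j i ≤ 2 * (blockInv u i j + blockInv u j i) := by
  rw [blockInv_of_lt u h]
  exact flip_count_le (apply_val_ne u (by simp [h.ne])) (apply_val_ne u (by simp))
    (apply_val_ne u (by simp)) (apply_val_ne u (by simp [h.ne]))

theorem flipInv_eq_iff_of_lt (u : Perm (Fin (2 * n))) {i j : Fin n} (h : i < j)
    (hi : u (ev i) < u (od i)) (hj : u (ev j) < u (od j)) :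
    flipInv u i j + flipInv u j i = 2 * (blockInv u i j + blockInv u j i) ↔
      ¬ (u (ev j) < u (ev i) ∧ u (od j) < u (od i)) := by
  rw [blockInv_of_lt u h]
  exact flip_count_eq_iff (apply_val_ne u (by simp [h.ne])) (apply_val_ne u (by simp))
    (apply_val_ne u (by simp)) (apply_val_ne u (by simp [h.ne])) hi hj

theorem inv_conj_eq_iff_good (u : Perm (Fin (2 * n))) :
    inv (u * wFPF n * u⁻¹) = n + 2 * inv u ↔ Good u := by
  -- The bound holds for the two orders of a pair of blocks together, so both sides are symmetrized
  -- before comparing termwise. The diagonal 2 in `G` accounts for the summand `n`, since `flipInv u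
  -- i i = 1`.
  let F : Fin n × Fin n → ℕ := fun p ↦ flipInv u p.1 p.2 + flipInv u p.2 p.1
  let G : Fin n × Fin n → ℕ := fun p ↦
    2 * (blockInv u p.1 p.2 + blockInv u p.2 p.1) + if p.1 = p.2 then 2 else 0
  have hF : ∑ p, F p = 2 * inv (u * wFPF n * u⁻¹) := by
    rw [inv_conj_eq_sum_flipInv, Fintype.sum_prod_type, two_mul]
    nth_rw 3 [Finset.sum_comm]
    simp only [F, Finset.sum_add_distrib]
  have hG : ∑ p, G p = 2 * (n + 2 * inv u) := by
    have h : ∑ i, ∑ j, (blockInv u i j + blockInv u j i) = 2 * inv u := by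
      rw [inv_eq_sum_blockInv, two_mul]
      nth_rw 3 [Finset.sum_comm]
      simp only [Finset.sum_add_distrib]
    rw [Fintype.sum_prod_type]
    simp only [G, Finset.sum_add_distrib, ← Finset.mul_sum] at h ⊢
    rw [h]
    simp
    ring
  have hle : ∀ p ∈ Finset.univ, F p ≤ G p := by
    rintro ⟨i, j⟩ -
    rcases lt_trichotomy i j with h | rfl | h
    · simpa [F, G, h.ne] using flipInv_le_of_lt u h
    · simp [F, G, flipInv_self]
    · have := flipInv_le_of_lt u h
      simp only [F, G, h.ne', if_false]
      omega
  -- Equality of the sums forces equality in every term: the diagonal says that blocks increase, the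
  -- other terms exclude badly ordered pairs.
  have hiff := Finset.sum_eq_sum_iff_of_le hle
  rw [hF, hG] at hiff
  rw [show inv (u * wFPF n * u⁻¹) = n + 2 * inv u ↔
    2 * inv (u * wFPF n * u⁻¹) = 2 * (n + 2 * inv u) by omega, hiff]
  have hdiag : ∀ i, F (i, i) = G (i, i) ↔ u (ev i) < u (od i) := by
    intro i
    rcases lt_or_gt_of_ne (u.injective.ne (ev_ne_od i i)) with h | h <;>
      simp [F, G, flipInv_self, blockInv_self, h, h.not_gt]
  constructor
  · intro H
    have h1 : ∀ i, u (ev i) < u (od i) := fun i ↦ (hdiag i).1 (H (i, i) (Finset.mem_univ _))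
    refine ⟨h1, fun i j hij ↦ (flipInv_eq_iff_of_lt u hij (h1 i) (h1 j)).1 ?_⟩
    simpa [F, G, hij.ne] using H (i, j) (Finset.mem_univ _)
  · rintro ⟨h1, h2⟩ ⟨i, j⟩ -
    rcases lt_trichotomy i j with h | rfl | h
    · simpa [F, G, h.ne] using (flipInv_eq_iff_of_lt u h (h1 i) (h1 j)).2 (h2 i j h)
    · exact (hdiag i).2 (h1 i)
    · have := (flipInv_eq_iff_of_lt u h (h1 j) (h1 i)).2 (h2 j i h)
      simp only [F, G, h.ne', if_false]
      omega

theorem inv_wFPF (n : ℕ) : inv (wFPF n) = n := by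
  have h : Good (1 : Perm (Fin (2 * n))) := by
    refine ⟨fun i ↦ ?_, fun i j hij ↦ ?_⟩ <;>
      simp only [Perm.one_apply, ev, od, Fin.lt_def] at * <;> omega
  simpa [inv_one] using (inv_conj_eq_iff_good 1).2 h

theorem inv_mem_atomsFPF_iff {x : Perm (Fin (2 * n))}
    (hex : ∃ u, u * wFPF n * u⁻¹ = x ∧ Good u) (u : Perm (Fin (2 * n))) :
    u ∈ (fun w ↦ w⁻¹) '' atomsFPF x ↔ u * wFPF n * u⁻¹ = x ∧ Good u := by
  have key : ∀ u : Perm (Fin (2 * n)),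
      (u⁻¹⁻¹ * wFPF n * u⁻¹ = x ∧ inv x = inv (wFPF n) + 2 * inv u⁻¹) ↔
        (u * wFPF n * u⁻¹ = x ∧ Good u) := by
    intro u
    rw [_root_.inv_inv, inv_inv, inv_wFPF, ← inv_conj_eq_iff_good]
    refine and_congr_right fun h ↦ ?_
    rw [h]
  obtain ⟨v, hv⟩ := hex
  rw [← key, ← mem_atoms_iff (isFPFInvolution_wFPF n) ⟨v⁻¹, (key v).2 hv⟩]
  constructor
  · rintro ⟨w, hw, rfl⟩
    simpa [atomsFPF] using hw
  · exact fun h ↦ ⟨u⁻¹, h, _root_.inv_inv u⟩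

end Blocks

/-! ### The order on lists of pairs -/

section Lists

/-- The list of entries of a list of pairs. -/
def flat (L : List (ℤ × ℤ)) : List ℤ := L.flatMap fun p ↦ [p.1, p.2]

@[simp] theorem flat_nil : flat [] = [] := rfl

@[simp] theorem flat_cons (p : ℤ × ℤ) (L : List (ℤ × ℤ)) :
    flat (p :: L) = p.1 :: p.2 :: flat L := rfl

@[simp] theorem flat_append (L L' : List (ℤ × ℤ)) : flat (L ++ L') = flat L ++ flat L' :=
  List.flatMap_append

theorem even_length_flat (L : List (ℤ × ℤ)) : Even (flat L).length := by
  induction L with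
  | nil => simp
  | cons p L ih =>
    rw [flat_cons, List.length_cons, List.length_cons]
    simpa [Nat.even_add_one] using ih

theorem flat_injective : Function.Injective flat := by
  intro L
  induction L with
  | nil =>
    intro L' h
    cases L' with
    | nil => rfl
    | cons => simp at h
  | cons p L ih =>
    intro L' h
    cases L' with
    | nil => simp at h
    | cons q L' =>
      simp only [flat_cons, List.cons.injEq] at h
      rw [ih h.2.2, Prod.ext h.1 h.2.1]

theorem exists_flat_eq : ∀ {l : List ℤ}, Even l.length → ∃ L, flat L = l
  | [], _ => ⟨[], rfl⟩
  | [_], h => by simp at h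
  | a :: b :: l, h => by
    obtain ⟨L, rfl⟩ := exists_flat_eq (l := l) (by simpa [Nat.even_add_one] using h)
    exact ⟨(a, b) :: L, rfl⟩

/-- The even lengths of the outer parts make a step act on whole blocks. -/
theorem fpfStep_iff {l l' : List ℤ} :
    FPFStep l l' ↔ ∃ (A B : List (ℤ × ℤ)) (a b c d : ℤ), a ≤ b ∧ b ≤ c ∧ c ≤ d ∧
      l = flat (A ++ (a, d) :: (b, c) :: B) ∧ l' = flat (A ++ (b, c) :: (a, d) :: B) := by
  constructor
  · rintro ⟨α, β, a, b, c, d, hα, hβ, hab, hbc, hcd, rfl, rfl⟩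
    obtain ⟨A, rfl⟩ := exists_flat_eq hα
    obtain ⟨B, rfl⟩ := exists_flat_eq hβ
    exact ⟨A, B, a, b, c, d, hab, hbc, hcd, by simp, by simp⟩
  · rintro ⟨A, B, a, b, c, d, hab, hbc, hcd, rfl, rfl⟩
    exact ⟨flat A, flat B, a, b, c, d, even_length_flat A, even_length_flat B, hab, hbc, hcd,
      by simp, by simp⟩

theorem fpfLe_iff {l l' : List ℤ} : FPFLe l l' ↔ Relation.ReflTransGen FPFStep l l' := by
  rw [Relation.reflTransGen_iff_eq_or_transGen, FPFLe, FPFLt, eq_comm]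

theorem FPFLe.refl (l : List ℤ) : FPFLe l l := .inl rfl

theorem FPFLe.trans {l l' l'' : List ℤ} (h : FPFLe l l') (h' : FPFLe l' l'') : FPFLe l l'' := by
  rw [fpfLe_iff] at *
  exact Relation.ReflTransGen.trans h h'

theorem FPFLe.cons {L L' : List (ℤ × ℤ)} (h : FPFLe (flat L) (flat L')) (p : ℤ × ℤ) :
    FPFLe (flat (p :: L)) (flat (p :: L')) := by
  rw [fpfLe_iff] at *
  refine Relation.ReflTransGen.lift (fun l ↦ p.1 :: p.2 :: l) (fun l l' hs ↦ ?_) _ _ h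
  obtain ⟨A, B, a, b, c, d, hab, hbc, hcd, rfl, rfl⟩ := fpfStep_iff.1 hs
  exact fpfStep_iff.2 ⟨p :: A, B, a, b, c, d, hab, hbc, hcd, rfl, rfl⟩

theorem FPFLe.swap {a b c d : ℤ} (hab : a ≤ b) (hbc : b ≤ c) (hcd : c ≤ d)
    (L : List (ℤ × ℤ)) :
    FPFLe (flat ((a, d) :: (b, c) :: L)) (flat ((b, c) :: (a, d) :: L)) :=
  .inr (.single (fpfStep_iff.2 ⟨[], L, a, b, c, d, hab, hbc, hcd, rfl, rfl⟩))

/-- `q` is not smaller than `p` in both entries. -/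
def NotBothLt (p q : ℤ × ℤ) : Prop := ¬ (q.1 < p.1 ∧ q.2 < p.2)

/-- The list of pairs `L` is a rearrangement of `M` without pairs preceded by a pair that is
larger in both entries. -/
def Arranged (M L : List (ℤ × ℤ)) : Prop := L.Perm M ∧ L.Pairwise NotBothLt

/-- Of two nested pairs neither is smaller in both entries, so either order is allowed; no other
relative order changes. -/
theorem arranged_swap_iff {M A B : List (ℤ × ℤ)} {a b c d : ℤ} (hab : a ≤ b) (hcd : c ≤ d) :
    Arranged M (A ++ (a, d) :: (b, c) :: B) ↔ Arranged M (A ++ (b, c) :: (a, d) :: B) := by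
  have hp : (A ++ (a, d) :: (b, c) :: B).Perm (A ++ (b, c) :: (a, d) :: B) :=
    (List.Perm.swap _ _ _).append_left A
  have h1 : NotBothLt (a, d) (b, c) := fun h ↦ h.1.not_ge hab
  have h2 : NotBothLt (b, c) (a, d) := fun h ↦ h.2.not_ge hcd
  refine and_congr ⟨hp.symm.trans, hp.trans⟩ ?_
  simp only [List.pairwise_append, List.pairwise_cons, List.mem_cons, forall_eq_or_imp, h1, h2,
    true_and, and_left_comm (a := NotBothLt _ (a, d)),
    and_left_comm (a := ∀ q ∈ B, NotBothLt (a, d) q)]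

theorem arranged_iff_of_fpfLe {M L L' : List (ℤ × ℤ)} (h : FPFLe (flat L) (flat L')) :
    Arranged M L ↔ Arranged M L' := by
  -- A chain runs through integer lists, so the induction carries an existential over lists of
  -- pairs, removed at the end by injectivity of `flat`.
  have key : ∀ l l', Relation.ReflTransGen FPFStep l l' →
      ((∃ L, flat L = l ∧ Arranged M L) ↔ ∃ L, flat L = l' ∧ Arranged M L) := by
    intro l l' h
    induction h with
    | refl => rfl
    | tail _ hs ih =>
      rw [ih]
      obtain ⟨A, B, a, b, c, d, hab, -, hcd, rfl, rfl⟩ := fpfStep_iff.1 hs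
      simp only [flat_injective.eq_iff, exists_eq_left, arranged_swap_iff hab hcd]
  simpa only [flat_injective.eq_iff, exists_eq_left] using key _ _ (fpfLe_iff.1 h)

/-- Whenever `q` must precede `p`, q.1 < p.1, and the hypothesis forces p.2 ≤ q.2: `p` is nested in
`q`, and exchanging them is a generating step. -/
theorem orderedInsert_fst_le (p : ℤ × ℤ) (hp : p.1 ≤ p.2) {L : List (ℤ × ℤ)}
    (h : ∀ q ∈ L, NotBothLt p q) :
    FPFLe (flat (L.orderedInsert (fun p q ↦ p.1 ≤ q.1) p)) (flat (p :: L)) := by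
  induction L with
  | nil => exact .refl _
  | cons q L ih =>
    rw [List.orderedInsert]
    split_ifs with hpq
    · exact .refl _
    · refine ((ih fun r hr ↦ h r (List.mem_cons_of_mem _ hr)).cons q).trans ?_
      have hq : p.2 ≤ q.2 := not_lt.1 fun hlt ↦ h q (List.mem_cons_self ..) ⟨not_le.1 hpq, hlt⟩
      exact FPFLe.swap (not_le.1 hpq).le hp hq L

/-- Here `p` moves right past `q` when q.2 < p.2; the hypothesis gives p.1 ≤ q.1, so `q` is nested
in `p` and the step goes up. -/
theorem le_orderedInsert_snd (p : ℤ × ℤ) {L : List (ℤ × ℤ)} (hL : ∀ q ∈ L, q.1 ≤ q.2)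
    (h : ∀ q ∈ L, NotBothLt p q) :
    FPFLe (flat (p :: L)) (flat (L.orderedInsert (fun p q ↦ p.2 ≤ q.2) p)) := by
  induction L with
  | nil => exact .refl _
  | cons q L ih =>
    rw [List.orderedInsert]
    split_ifs with hpq
    · exact .refl _
    · refine FPFLe.trans ?_ ((ih (fun r hr ↦ hL r (List.mem_cons_of_mem _ hr))
        fun r hr ↦ h r (List.mem_cons_of_mem _ hr)).cons q)
      have hq : p.1 ≤ q.1 := not_lt.1 fun hlt ↦ h q (List.mem_cons_self ..) ⟨hlt, not_le.1 hpq⟩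
      exact FPFLe.swap hq (hL q (List.mem_cons_self ..)) (not_le.1 hpq).le L

theorem insertionSort_fst_le {L : List (ℤ × ℤ)} (hL : ∀ q ∈ L, q.1 ≤ q.2)
    (h : L.Pairwise NotBothLt) :
    FPFLe (flat (L.insertionSort fun p q ↦ p.1 ≤ q.1)) (flat L) := by
  induction L with
  | nil => exact .refl _
  | cons p L ih =>
    rw [List.pairwise_cons] at h
    rw [List.forall_mem_cons] at hL
    refine FPFLe.trans ?_ ((ih hL.2 h.2).cons p)
    exact orderedInsert_fst_le p hL.1 fun q hq ↦ h.1 q ((List.mem_insertionSort _).1 hq)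

theorem le_insertionSort_snd {L : List (ℤ × ℤ)} (hL : ∀ q ∈ L, q.1 ≤ q.2)
    (h : L.Pairwise NotBothLt) :
    FPFLe (flat L) (flat (L.insertionSort fun p q ↦ p.2 ≤ q.2)) := by
  induction L with
  | nil => exact .refl _
  | cons p L ih =>
    rw [List.pairwise_cons] at h
    rw [List.forall_mem_cons] at hL
    refine ((ih hL.2 h.2).cons p).trans ?_
    exact le_orderedInsert_snd p (fun q hq ↦ hL.2 q ((List.mem_insertionSort _).1 hq))
      fun q hq ↦ h.1 q ((List.mem_insertionSort _).1 hq)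

theorem arranged_iff_sorted_fst_le {M L : List (ℤ × ℤ)} (hM : ∀ q ∈ M, q.1 ≤ q.2)
    (hs : M.Pairwise fun p q ↦ p.1 < q.1) :
    Arranged M L ↔ FPFLe (flat M) (flat L) := by
  constructor
  · rintro ⟨hp, hL⟩
    have : Std.Total (fun p q : ℤ × ℤ ↦ p.1 ≤ q.1) := ⟨fun p q ↦ le_total p.1 q.1⟩
    have : IsTrans (ℤ × ℤ) (fun p q ↦ p.1 ≤ q.1) := ⟨fun _ _ _ ↦ le_trans⟩
    -- First entries in `M` are distinct, so only one rearrangement is sorted by them.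
    have heq : L.insertionSort (fun p q ↦ p.1 ≤ q.1) = M := by
      refine List.Perm.eq_of_pairwise ?_ (List.pairwise_insertionSort _ L)
        (hs.imp fun h ↦ h.le) ((List.perm_insertionSort _ L).trans hp)
      intro p q hpM hqM h1 h2
      rw [((List.perm_insertionSort _ L).trans hp).mem_iff] at hpM
      by_contra hne
      have : Std.Symm (fun p q : ℤ × ℤ ↦ p.1 ≠ q.1) := ⟨fun _ _ h ↦ h.symm⟩
      exact (hs.imp fun h ↦ h.ne : M.Pairwise fun p q ↦ p.1 ≠ q.1).forall hpM hqM hne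
        (le_antisymm h1 h2)
    have := insertionSort_fst_le (fun q hq ↦ hM q (hp.mem_iff.1 hq)) hL
    rwa [heq] at this
  · intro h
    rw [← arranged_iff_of_fpfLe h]
    exact ⟨.refl _, hs.imp fun h h' ↦ h'.1.not_gt h⟩

theorem arranged_iff_le_sorted_snd {M L : List (ℤ × ℤ)} (hM : ∀ q ∈ M, q.1 ≤ q.2)
    (hs : M.Pairwise fun p q ↦ p.2 < q.2) :
    Arranged M L ↔ FPFLe (flat L) (flat M) := by
  constructor
  · rintro ⟨hp, hL⟩
    have : Std.Total (fun p q : ℤ × ℤ ↦ p.2 ≤ q.2) := ⟨fun p q ↦ le_total p.2 q.2⟩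
    have : IsTrans (ℤ × ℤ) (fun p q ↦ p.2 ≤ q.2) := ⟨fun _ _ _ ↦ le_trans⟩
    have heq : L.insertionSort (fun p q ↦ p.2 ≤ q.2) = M := by
      refine List.Perm.eq_of_pairwise ?_ (List.pairwise_insertionSort _ L)
        (hs.imp fun h ↦ h.le) ((List.perm_insertionSort _ L).trans hp)
      intro p q hpM hqM h1 h2
      rw [((List.perm_insertionSort _ L).trans hp).mem_iff] at hpM
      by_contra hne
      have : Std.Symm (fun p q : ℤ × ℤ ↦ p.2 ≠ q.2) := ⟨fun _ _ h ↦ h.symm⟩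
      exact (hs.imp fun h ↦ h.ne : M.Pairwise fun p q ↦ p.2 ≠ q.2).forall hpM hqM hne
        (le_antisymm h1 h2)
    have := le_insertionSort_snd (fun q hq ↦ hM q (hp.mem_iff.1 hq)) hL
    rwa [heq] at this
  · intro h
    rw [arranged_iff_of_fpfLe h]
    exact ⟨.refl _, hs.imp fun h h' ↦ h'.2.not_gt h⟩

end Lists

/-! ### One-line representations -/

section OneLine

/-- The letter `i`, with values starting at `1`. -/
def letter {m : ℕ} (i : Fin m) : ℤ := ((i : ℕ) : ℤ) + 1

@[simp] theorem letter_lt {m : ℕ} {i j : Fin m} : letter i < letter j ↔ i < j := by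
  simp [letter]

@[simp] theorem letter_le {m : ℕ} {i j : Fin m} : letter i ≤ letter j ↔ i ≤ j := by
  simp [letter]

@[simp] theorem letter_inj {m : ℕ} {i j : Fin m} : letter i = letter j ↔ i = j := by
  simp [letter, Fin.ext_iff]

theorem oneLine_ofWord {m : ℕ} (l : List (Fin m)) (h : l.Nodup) (h' : ∀ i, i ∈ l) :
    oneLine (ofWord l h h') = l.map letter := by
  refine List.ext_getElem (by simpa [oneLine] using length_of_nodup h h') fun i h1 h2 ↦ ?_
  simp [oneLine, ofWord, letter]

variable {n : ℕ}

/-- The list of blocks of the one-line representation. -/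
def blocks (u : Perm (Fin (2 * n))) : List (ℤ × ℤ) :=
  List.ofFn fun i ↦ (letter (u (ev i)), letter (u (od i)))

theorem flat_blocks (u : Perm (Fin (2 * n))) : flat (blocks u) = oneLine u := by
  rw [oneLine, List.ofFn_mul', flat, blocks, List.flatMap_def, List.map_ofFn]
  congr 2

/-- The cycles `(a, b)` of `x`, sorted by `a`. -/
def cyclesFst {m : ℕ} (x : Perm (Fin m)) : List (ℤ × ℤ) :=
  (((cyc x).image Prod.fst).sort (· ≤ ·)).map fun a ↦ (letter a, letter (x a))

/-- The cycles `(c, d)` of `x`, sorted by `d`. -/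
def cyclesSnd {m : ℕ} (x : Perm (Fin m)) : List (ℤ × ℤ) :=
  (((cyc x).image Prod.snd).sort (· ≤ ·)).map fun d ↦ (letter (x d), letter d)

theorem oneLine_hatZero {m : ℕ} {x : Perm (Fin m)} (hx : IsFPFInvolution x) :
    oneLine (hatZero x hx) = flat (cyclesFst x) := by
  rw [hatZero, oneLine_ofWord, zeroWord, List.map_flatMap, cyclesFst, flat, List.flatMap_map]
  rfl

theorem oneLine_hatOne {m : ℕ} {x : Perm (Fin m)} (hx : IsFPFInvolution x) :
    oneLine (hatOne x hx) = flat (cyclesSnd x) := by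
  rw [hatOne, oneLine_ofWord, oneWord, List.map_flatMap, cyclesSnd, flat, List.flatMap_map]
  rfl

theorem pairwise_cyclesFst {m : ℕ} (x : Perm (Fin m)) :
    (cyclesFst x).Pairwise fun p q ↦ p.1 < q.1 := by
  rw [cyclesFst, List.pairwise_map]
  simpa using (Finset.sortedLT_sort _).pairwise

theorem pairwise_cyclesSnd {m : ℕ} (x : Perm (Fin m)) :
    (cyclesSnd x).Pairwise fun p q ↦ p.2 < q.2 := by
  rw [cyclesSnd, List.pairwise_map]
  simpa using (Finset.sortedLT_sort _).pairwise

theorem mem_cyclesFst {m : ℕ} {x : Perm (Fin m)} {p : ℤ × ℤ} :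
    p ∈ cyclesFst x ↔ ∃ a, a ≤ x a ∧ (letter a, letter (x a)) = p := by
  simp only [cyclesFst, List.mem_map, Finset.mem_sort, mem_fst]

theorem mem_cyclesSnd {m : ℕ} {x : Perm (Fin m)} (hx : IsFPFInvolution x) {p : ℤ × ℤ} :
    p ∈ cyclesSnd x ↔ ∃ a, a ≤ x a ∧ (letter a, letter (x a)) = p := by
  simp only [cyclesSnd, List.mem_map, Finset.mem_sort, mem_snd hx]
  constructor
  · rintro ⟨d, h, rfl⟩
    exact ⟨x d, by rwa [hx.apply_apply], by rw [hx.apply_apply]⟩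
  · rintro ⟨a, h, rfl⟩
    exact ⟨x a, by rwa [hx.apply_apply], by rw [hx.apply_apply]⟩

theorem nodup_cyclesFst {m : ℕ} (x : Perm (Fin m)) : (cyclesFst x).Nodup :=
  (pairwise_cyclesFst x).imp fun h h' ↦ h.ne (congrArg Prod.fst h')

theorem cyclesSnd_perm {m : ℕ} {x : Perm (Fin m)} (hx : IsFPFInvolution x) :
    (cyclesSnd x).Perm (cyclesFst x) := by
  have h : (cyclesSnd x).Nodup :=
    (pairwise_cyclesSnd x).imp fun h h' ↦ h.ne (congrArg Prod.snd h')
  rw [List.perm_ext_iff_of_nodup h (nodup_cyclesFst x)]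
  intro p
  rw [mem_cyclesSnd hx, mem_cyclesFst]

/-- The conjugate of w_FPF by `u` exchanges the two entries of each block, so its cycles are the
blocks. Neither list has repetitions, so comparing members suffices. -/
theorem blocks_perm_iff {x : Perm (Fin (2 * n))} (hx : IsFPFInvolution x)
    (u : Perm (Fin (2 * n))) :
    (blocks u).Perm (cyclesFst x) ↔
      u * wFPF n * u⁻¹ = x ∧ ∀ i, u (ev i) < u (od i) := by
  have hnd : (blocks u).Nodup := by
    refine List.nodup_ofFn.2 fun i j h ↦ ?_
    simpa using congrArg Prod.fst h
  rw [List.perm_ext_iff_of_nodup hnd (nodup_cyclesFst x)]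
  simp only [mem_cyclesFst, blocks, List.mem_ofFn]
  constructor
  · intro h
    have h' : ∀ i, u (ev i) ≤ x (u (ev i)) ∧ x (u (ev i)) = u (od i) := by
      intro i
      obtain ⟨a, ha, he⟩ := (h _).1 ⟨i, rfl⟩
      simp only [Prod.mk.injEq, letter_inj] at he
      rw [← he.1, ← he.2]
      exact ⟨ha, rfl⟩
    constructor
    · rw [mul_inv_eq_iff_eq_mul]
      ext r
      obtain ⟨i, rfl | rfl⟩ := eq_ev_or_od r
      · simp [(h' i).2]
      · simp [← (h' i).2, hx.apply_apply]
    · intro i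
      rw [← (h' i).2]
      exact lt_of_le_of_ne (h' i).1 (hx.2 _).symm
  · rintro ⟨rfl, h⟩ p
    constructor
    · rintro ⟨i, rfl⟩
      exact ⟨u (ev i), by simpa using (h i).le, by simp⟩
    · rintro ⟨a, ha, rfl⟩
      obtain ⟨r, rfl⟩ := u.surjective a
      obtain ⟨i, rfl | rfl⟩ := eq_ev_or_od r
      · exact ⟨i, by simp⟩
      · simp only [Perm.mul_apply, Perm.inv_def, symm_apply_apply, wFPF_od] at ha
        exact absurd (h i) ha.not_gt

theorem arranged_blocks_iff {x : Perm (Fin (2 * n))} (hx : IsFPFInvolution x)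
    (u : Perm (Fin (2 * n))) :
    Arranged (cyclesFst x) (blocks u) ↔ u * wFPF n * u⁻¹ = x ∧ Good u := by
  rw [Arranged, blocks_perm_iff hx, Good, blocks, List.pairwise_ofFn, and_assoc]
  simp [NotBothLt]

theorem arranged_iff_hatZero_le {x : Perm (Fin (2 * n))} (hx : IsFPFInvolution x)
    (u : Perm (Fin (2 * n))) :
    Arranged (cyclesFst x) (blocks u) ↔ FPFLe (oneLine (hatZero x hx)) (oneLine u) := by
  rw [oneLine_hatZero, ← flat_blocks]
  refine arranged_iff_sorted_fst_le (fun p hp ↦ ?_) (pairwise_cyclesFst x)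
  obtain ⟨a, ha, rfl⟩ := mem_cyclesFst.1 hp
  simpa using ha

theorem arranged_iff_le_hatOne {x : Perm (Fin (2 * n))} (hx : IsFPFInvolution x)
    (u : Perm (Fin (2 * n))) :
    Arranged (cyclesFst x) (blocks u) ↔ FPFLe (oneLine u) (oneLine (hatOne x hx)) := by
  rw [oneLine_hatOne, ← flat_blocks, ← arranged_iff_le_sorted_snd ?_ (pairwise_cyclesSnd x)]
  · have h := cyclesSnd_perm hx
    exact and_congr_left fun _ ↦ ⟨fun h' ↦ h'.trans h.symm, fun h' ↦ h'.trans h⟩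
  · intro p hp
    obtain ⟨a, ha, rfl⟩ := (mem_cyclesSnd hx).1 hp
    simpa using ha

end OneLine

end FPFAtoms

theorem theorem6p21 (n : ℕ) (x : Equiv.Perm (Fin (2 * n))) (hx : FPFAtoms.IsFPFInvolution x) :
    (fun w ↦ w⁻¹) '' FPFAtoms.atomsFPF x =
        {u : Equiv.Perm (Fin (2 * n)) |
          FPFAtoms.FPFLe (FPFAtoms.oneLine (FPFAtoms.hatZero x hx)) (FPFAtoms.oneLine u)} ∧
      (fun w ↦ w⁻¹) '' FPFAtoms.atomsFPF x =
        {u : Equiv.Perm (Fin (2 * n)) |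
          FPFAtoms.FPFLe (FPFAtoms.oneLine u) (FPFAtoms.oneLine (FPFAtoms.hatOne x hx))} := by
  -- Reflexivity of the order at `hatZero` supplies the element attaining the length bound.
  have hex : ∃ u, u * FPFAtoms.wFPF n * u⁻¹ = x ∧ FPFAtoms.Good u :=
    ⟨FPFAtoms.hatZero x hx, (FPFAtoms.arranged_blocks_iff hx _).1
      ((FPFAtoms.arranged_iff_hatZero_le hx _).2 (.refl _))⟩
  constructor
  · ext u
    rw [FPFAtoms.inv_mem_atomsFPF_iff hex, ← FPFAtoms.arranged_blocks_iff hx,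
      FPFAtoms.arranged_iff_hatZero_le hx, Set.mem_ofPred_eq]
  · ext u
    rw [FPFAtoms.inv_mem_atomsFPF_iff hex, ← FPFAtoms.arranged_blocks_iff hx,
      FPFAtoms.arranged_iff_le_hatOne hx, Set.mem_ofPred_eq]
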